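/- An algebra is a nonempty set with a fixed collection of finitary operations, and a variety is an equationally definable class of algebras of one language. For an algebra $A$, let $\mathrm{Con}(A)$ be its congruence lattice and $\Delta$ the equality relation; $\mathrm{Cg}(\vec a,\vec b)$ is the congruence generated by the pairs $(a_k,b_k)$. Congruences $\theta,\theta^*$ are complementary factor congruences if $\theta\cap\theta^*=\Delta$ and $\theta\circ\theta^*=A\times A$; a factor congruence is a member of such a pair. A variety $\mathcal V$ has Boolean factor congruences (BFC) if for every $A\in\mathcal V$ the set of factor congruences of $A$ is a distributive sublattice of $\mathrm{Con}(A)$. Let $n\ge 0$ and let $s_i,t_i$ ($1\le i\le n$) be $(2i+2)$-ary terms. For $\vec X=(x,y,z,w,x_1,y_1,\dots,x_n,y_n)\in A^{4+2n}$ define tuples $(x',y',z',w',x'_1,y'_1,\dots,x'_n,y'_n)$ recursively in $j=1,\dots,n$, where $\vec p_j:=(x',y',z',w',x'_1,y'_1,\dots,x'_{j-1},y'_{j-1})$: - $\sigma(\vec X)$: $(x',y',z',w')=(x,y,x,y)$, $x'_j=s_j(\vec p_j)$, $y'_j=y_j$; - $\sigma^*(\vec X)$: $(x',y',z',w')=(x,x,z,w)$,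 $x'_j=t_j(\vec p_j)$, $y'_j=y_j$; - $\rho(\vec X)$: $(x',y',z',w')=(x,y,z,z)$, $x'_j=x_j$, $y'_j=s_j(\vec p_j)$; - $\rho^*(\vec X)$: $(x',y',z',w')=(x,y,z,w)$, $x'_j=x_j$, $y'_j=t_j(\vec p_j)$. For $\theta,\theta^*,\varphi,\varphi^*\in\mathrm{Con}(A)$ put $\delta_0=\epsilon_0=\Delta$, $\delta_{k+1}=(\theta\vee\epsilon_k)\cap(\theta^*\vee\epsilon_k)$ and $\epsilon_{k+1}=(\varphi\vee\delta_k)\cap(\varphi^*\vee\delta_k)$. **Corollary.** A variety $\mathcal V$ has BFC if and only if there exist integers $N,n\ge 0$ and $(2i+2)$-ary terms $s_i,t_i$ for $i=1,\dots,n$ such that, for all $A\in\mathcal V$, all $\theta,\theta^*,\varphi,\varphi^*\in\mathrm{Con}(A)$ and all $\vec X=(x,y,z,w,x_1,y_1,\dots,x_n,y_n)\in A^{4+2n}$, if $$\mathrm{Cg}(\vec X,\sigma(\vec X))\subseteq\theta,\quad \mathrm{Cg}(\vec X,\sigma^*(\vec X))\subseteq\theta^*,\quad \mathrm{Cg}(\vec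 X,\rho(\vec X))\subseteq\varphi,\quad \mathrm{Cg}(\vec X,\rho^*(\vec X))\subseteq\varphi^*,$$ then $(x,y)\in\varphi\vee\delta_N$. -/

import Mathlib

universe u v w

namespace UA

/-- A set of identities `p ≈ q` over countably many variables. The variety it axiomatizes is the
class of all nonempty algebras satisfying it. -/
abbrev Identities (L : FirstOrder.Language.{u, v}) : Type u := Set (L.Term ℕ × L.Term ℕ)

/-- `A` satisfies all identities in `E`. -/
def Satisfies {L : FirstOrder.Language.{u, v}} (E : Identities L) (A : Type w) [L.Structure A] : Prop :=
  ∀ e ∈ E, ∀ a : ℕ → A, e.1.realize a = e.2.realize a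

/-- Congruences of an algebra: equivalence relations compatible with all basic operations. -/
@[ext]
structure Congruence (L : FirstOrder.Language.{u, v}) (A : Type w) [L.Structure A] extends Setoid A where
  map_rel : ∀ {m : ℕ} (f : L.Functions m) (a b : Fin m → A),
    (∀ i, r (a i) (b i)) → r (FirstOrder.Language.Structure.funMap f a) (FirstOrder.Language.Structure.funMap f b)

namespace Congruence

variable {L : FirstOrder.Language.{u, v}} {A : Type w} [L.Structure A]

/-- Congruences are ordered by inclusion. -/
instance : PartialOrder (Congruence L A) where
  le θ φ := ∀ a b, θ.r a b → φ.r a b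
  le_refl _ _ _ h := h
  le_trans _ _ _ h₁ h₂ a b h := h₂ a b (h₁ a b h)
  le_antisymm θ φ h₁ h₂ := by
    apply Congruence.ext
    funext a b
    exact propext ⟨h₁ a b, h₂ a b⟩

/-- The intersection of a set of congruences. -/
instance : InfSet (Congruence L A) where
  sInf S :=
    { r := fun a b => ∀ θ ∈ S, θ.r a b
      iseqv :=
        ⟨fun a θ _ => θ.iseqv.refl a, fun h θ hθ => θ.iseqv.symm (h θ hθ),
          fun h₁ h₂ θ hθ => θ.iseqv.trans (h₁ θ hθ) (h₂ θ hθ)⟩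
      map_rel := fun f a b h θ hθ => θ.map_rel f a b fun i => h i θ hθ }

theorem isGLB_sInf (S : Set (Congruence L A)) : IsGLB S (sInf S) :=
  ⟨fun θ hθ _ _ h => h θ hθ, fun _ hψ a b h _ hθ => hψ hθ a b h⟩

/-- The complete lattice of congruences: meets are intersections, `⊥` is equality, `⊤` is the
universal relation, and the join is the least congruence above. -/
instance : CompleteLattice (Congruence L A) where
  __ := completeLatticeOfInf (Congruence L A) isGLB_sInf
  inf θ φ :=
    { r := fun a b => θ.r a b ∧ φ.r a b
      iseqv :=
        ⟨fun a => ⟨θ.iseqv.refl a, φ.iseqv.refl a⟩,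
          fun h => ⟨θ.iseqv.symm h.1, φ.iseqv.symm h.2⟩,
          fun h₁ h₂ => ⟨θ.iseqv.trans h₁.1 h₂.1, φ.iseqv.trans h₁.2 h₂.2⟩⟩
      map_rel := fun f a b h =>
        ⟨θ.map_rel f a b fun i => (h i).1, φ.map_rel f a b fun i => (h i).2⟩ }
  inf_le_left _ _ _ _ h := h.1
  inf_le_right _ _ _ _ h := h.2
  le_inf _ _ _ h₁ h₂ a b h := ⟨h₁ a b h, h₂ a b h⟩
  bot :=
    { r := fun a b => a = b
      iseqv := ⟨fun _ => rfl, fun h => h.symm, fun h₁ h₂ => h₁.trans h₂⟩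
      map_rel := fun f a b h => by rw [funext h] }
  bot_le θ a b h := by
    have h' : a = b := h
    subst h'
    exact θ.iseqv.refl a
  top :=
    { r := fun _ _ => True
      iseqv := ⟨fun _ => trivial, fun _ => trivial, fun _ _ => trivial⟩
      map_rel := fun _ _ _ _ => trivial }
  le_top _ _ _ _ := trivial

/-- `Cg a b` is the congruence generated by the pairs `(a i, b i)`. -/
def Cg (L : FirstOrder.Language.{u, v}) {A : Type w} [L.Structure A] {ι : Type*} (a b : ι → A) :
    Congruence L A :=
  sInf {θ | ∀ i, θ.r (a i) (b i)}

/-- `θ` and `θs` are complementary factor congruences: `θ ∩ θs = Δ` and `θ ∘ θs = ∇`. -/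
def Complementary (θ θs : Congruence L A) : Prop :=
  θ ⊓ θs = ⊥ ∧ ∀ a b : A, ∃ c : A, θ.r a c ∧ θs.r c b

/-- The set of factor congruences of `A`. -/
def factorCongruences (L : FirstOrder.Language.{u, v}) (A : Type w) [L.Structure A] :
    Set (Congruence L A) :=
  {θ | ∃ θs, Complementary θ θs}

/-- The pair `(δ_k, ε_k)`, where `δ_0 = ε_0 = Δ`,
`δ_{k+1} = (θ ∨ ε_k) ∩ (θs ∨ ε_k)` and `ε_{k+1} = (φ ∨ δ_k) ∩ (φs ∨ δ_k)`. -/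
def deltaEps (θ θs φ φs : Congruence L A) : ℕ → Congruence L A × Congruence L A
  | 0 => (⊥, ⊥)
  | k + 1 =>
    ((θ ⊔ (deltaEps θ θs φ φs k).2) ⊓ (θs ⊔ (deltaEps θ θs φ φs k).2),
      (φ ⊔ (deltaEps θ θs φ φs k).1) ⊓ (φs ⊔ (deltaEps θ θs φ φs k).1))

/-- The congruence `δ_k`. -/
def delta (θ θs φ φs : Congruence L A) (k : ℕ) : Congruence L A :=
  (deltaEps θ θs φ φs k).1

end Congruence

/-- Boolean factor congruences: in every algebra of the variety the factor congruences form a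
distributive sublattice of the congruence lattice. -/
def HasBFC {L : FirstOrder.Language.{u, v}} (E : Identities L) : Prop :=
  ∀ (A : Type (max u w)) [L.Structure A] [Nonempty A], Satisfies E A →
    IsSublattice (Congruence.factorCongruences L A) ∧
      ∀ θ ∈ Congruence.factorCongruences L A, ∀ φ ∈ Congruence.factorCongruences L A,
        ∀ ψ ∈ Congruence.factorCongruences L A, θ ⊓ (φ ⊔ ψ) = (θ ⊓ φ) ⊔ (θ ⊓ ψ)

/-- The `2 * m + 4` variables `x, y, z, w, x_1, y_1, …, x_m, y_m`;
`x_{i+1}` and `y_{i+1}` are `xs i` and `ys i`. -/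
inductive Var (m : ℕ) : Type
  | x : Var m
  | y : Var m
  | z : Var m
  | w : Var m
  | xs (i : Fin m) : Var m
  | ys (i : Fin m) : Var m

namespace Var

/-- The inclusion of `x, y, z, w, x_1, y_1, …, x_m, y_m` into the longer list of variables. -/
def lift {m n : ℕ} (h : m ≤ n) : Var m → Var n
  | x => x
  | y => y
  | z => z
  | w => w
  | xs i => xs (i.castLE h)
  | ys i => ys (i.castLE h)

/-- The stage of the recursions below at which a variable receives its value. -/
def stage {n : ℕ} : Var n → ℕ
  | xs i => i + 1
  | ys i => i + 1
  | _ => 0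

theorem stage_lift_lt {n : ℕ} (j : Fin n) (p : Var (j : ℕ)) :
    (p.lift j.isLt.le).stage < (j : ℕ) + 1 := by
  cases p with
  | xs i => simp [lift, stage]
  | ys i => simp [lift, stage]
  | _ => simp [lift, stage]

end Var

section Tuples

variable {L : FirstOrder.Language.{u, v}} {A : Type w} [L.Structure A] {n : ℕ}

/-- `σ(a,b,c,d,a_1,b_1,…)`: `x = a`, `y = b`, `z = a`, `w = b`, `y_j = b_j` and
`x_j = s_j(x,y,z,w,x_1,y_1,…,x_{j-1},y_{j-1})`. -/
def sigma (s : (j : Fin n) → L.Term (Var j)) (X : Var n → A) : Var n → A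
  | .x => X .x
  | .y => X .y
  | .z => X .x
  | .w => X .y
  | .xs j => (s j).realize fun p : Var (j : ℕ) => sigma s X (p.lift j.isLt.le)
  | .ys j => X (.ys j)
termination_by p => p.stage
decreasing_by exact Var.stage_lift_lt j p

/-- `σ*(a,b,c,d,a_1,b_1,…)`: `x = a`, `y = a`, `z = c`, `w = d`, `y_j = b_j` and
`x_j = t_j(x,y,z,w,x_1,y_1,…,x_{j-1},y_{j-1})`. -/
def sigmaStar (t : (j : Fin n) → L.Term (Var j)) (X : Var n → A) : Var n → A
  | .x => X .x
  | .y => X .x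
  | .z => X .z
  | .w => X .w
  | .xs j => (t j).realize fun p : Var (j : ℕ) => sigmaStar t X (p.lift j.isLt.le)
  | .ys j => X (.ys j)
termination_by p => p.stage
decreasing_by exact Var.stage_lift_lt j p

/-- `ρ(a,b,c,d,a_1,b_1,…)`: `x = a`, `y = b`, `z = c`, `w = c`, `x_j = a_j` and
`y_j = s_j(x,y,z,w,x_1,y_1,…,x_{j-1},y_{j-1})`. -/
def rho (s : (j : Fin n) → L.Term (Var j)) (X : Var n → A) : Var n → A
  | .x => X .x
  | .y => X .y
  | .z => X .z
  | .w => X .z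
  | .xs j => X (.xs j)
  | .ys j => (s j).realize fun p : Var (j : ℕ) => rho s X (p.lift j.isLt.le)
termination_by p => p.stage
decreasing_by exact Var.stage_lift_lt j p

/-- `ρ*(a,b,c,d,a_1,b_1,…)`: `x = a`, `y = b`, `z = c`, `w = d`, `x_j = a_j` and
`y_j = t_j(x,y,z,w,x_1,y_1,…,x_{j-1},y_{j-1})`. -/
def rhoStar (t : (j : Fin n) → L.Term (Var j)) (X : Var n → A) : Var n → A
  | .x => X .x
  | .y => X .y
  | .z => X .z
  | .w => X .w
  | .xs j => X (.xs j)
  | .ys j => (t j).realize fun p : Var (j : ℕ) => rhoStar t X (p.lift j.isLt.le)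
termination_by p => p.stage
decreasing_by exact Var.stage_lift_lt j p

end Tuples

end UA

namespace UA

open FirstOrder FirstOrder.Language

/-! BFC is governed by a rectangle property: if `θ`, `θs` are complementary, `φ` is a factor
congruence, and `x θs y`, `x θ z`, `y θ w`, `z φ w`, then `x φ y` (`FactorsDecompose`). It makes
factor congruences permute, and then yields sublattice and distributivity.

The terms imply this property: complementary pairs solve the system in the `x_j`, `y_j` step by step
(`exists_isSolution`), and every `δ_k` is `Δ`, so the conclusion reads `x φ y`.

Conversely, take a free algebra in which any `s`, `t` have formal witnesses `X s t`, `Y s t`, with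
the congruences that make them witness `θ ∘ θs` and `φ ∘ φs`. Dividing by the union `Ω` of the chain
`δ_k` forces both intersections to be trivial, so distributivity in the quotient gives `(x, y) ∈ φ ∨
Ω`. By compactness one `N` and finitely many pairs `(s, t)` suffice. Listed so that each pair is
built from earlier witnesses, they give the terms `s_j`, `t_j`; evaluating the generic algebra at a
solution transfers the conclusion to any algebra of the variety. -/

theorem realize_comp_of_map_funMap {L : FirstOrder.Language.{u, v}} {A B : Type*} [L.Structure A]
    [L.Structure B] (h : A → B)
    (hh : ∀ {m : ℕ} (f : L.Functions m) (a : Fin m → A),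
      h (Structure.funMap f a) = Structure.funMap f fun i => h (a i))
    {α : Type*} (t : L.Term α) (a : α → A) :
    h (t.realize a) = t.realize fun i => h (a i) := by
  induction t with
  | var i => rfl
  | func f ts ih => simp only [Term.realize, hh, ih]

/-! ### Congruences and their pullback along homomorphisms -/

namespace Congruence

section Basic

variable {L : FirstOrder.Language.{u, v}} {A : Type*} [L.Structure A]

theorem refl (θ : Congruence L A) (a : A) : θ.r a a := θ.iseqv.refl a

theorem symm (θ : Congruence L A) {a b : A} (h : θ.r a b) : θ.r b a := θ.iseqv.symm h

theorem trans (θ : Congruence L A) {a b c : A} (h : θ.r a b) (h' : θ.r b c) : θ.r a c :=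
  θ.iseqv.trans h h'

theorem realize_r (θ : Congruence L A) {α : Type*} (t : L.Term α) {a b : α → A}
    (h : ∀ i, θ.r (a i) (b i)) : θ.r (t.realize a) (t.realize b) := by
  induction t with
  | var i => exact h i
  | func f ts ih => exact θ.map_rel f _ _ ih

theorem r_of_Cg_le {ι : Type*} {a b : ι → A} {θ : Congruence L A} (h : Cg L a b ≤ θ) (i : ι) :
    θ.r (a i) (b i) :=
  h _ _ fun _ hψ => hψ i

theorem Cg_le {ι : Type*} {a b : ι → A} {θ : Congruence L A} (h : ∀ i, θ.r (a i) (b i)) :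
    Cg L a b ≤ θ :=
  sInf_le h

/-- The congruence induced on `A` by a congruence of `B` along a homomorphism. -/
def comap {B : Type*} [L.Structure B] (h : A → B)
    (hh : ∀ {m : ℕ} (f : L.Functions m) (a : Fin m → A),
      h (Structure.funMap f a) = Structure.funMap f fun i => h (a i))
    (θ : Congruence L B) : Congruence L A where
  r a b := θ.r (h a) (h b)
  iseqv := ⟨fun _ => θ.refl _, θ.symm, θ.trans⟩
  map_rel f a b hab := by
    rw [hh, hh]
    exact θ.map_rel f _ _ hab

section Comap

variable {B : Type*} [L.Structure B] (h : A → B)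
  (hh : ∀ {m : ℕ} (f : L.Functions m) (a : Fin m → A),
    h (Structure.funMap f a) = Structure.funMap f fun i => h (a i))

theorem comap_mono {θ φ : Congruence L B} (hle : θ ≤ φ) : comap h hh θ ≤ comap h hh φ :=
  fun _ _ hab => hle _ _ hab

theorem sup_le_comap {θ φ : Congruence L A} {θ' φ' : Congruence L B} (hθ : θ ≤ comap h hh θ')
    (hφ : φ ≤ comap h hh φ') : θ ⊔ φ ≤ comap h hh (θ' ⊔ φ') :=
  sup_le (hθ.trans (comap_mono h hh le_sup_left)) (hφ.trans (comap_mono h hh le_sup_right))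

theorem inf_le_comap {θ φ : Congruence L A} {θ' φ' : Congruence L B} (hθ : θ ≤ comap h hh θ')
    (hφ : φ ≤ comap h hh φ') : θ ⊓ φ ≤ comap h hh (θ' ⊓ φ') :=
  fun _ _ hab => ⟨hθ _ _ hab.1, hφ _ _ hab.2⟩

/-- The recursion uses only joins and meets, and both respect inclusion into a pullback. This
carries the generic conclusion to an arbitrary algebra. -/
theorem deltaEps_le_comap {θ θs φ φs : Congruence L A} {θ' θs' φ' φs' : Congruence L B}
    (hθ : θ ≤ comap h hh θ') (hθs : θs ≤ comap h hh θs') (hφ : φ ≤ comap h hh φ')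
    (hφs : φs ≤ comap h hh φs') (k : ℕ) :
    (deltaEps θ θs φ φs k).1 ≤ comap h hh (deltaEps θ' θs' φ' φs' k).1 ∧
      (deltaEps θ θs φ φs k).2 ≤ comap h hh (deltaEps θ' θs' φ' φs' k).2 := by
  induction k with
  | zero => exact ⟨bot_le, bot_le⟩
  | succ k ih =>
    exact ⟨inf_le_comap h hh (sup_le_comap h hh hθ ih.2) (sup_le_comap h hh hθs ih.2),
      inf_le_comap h hh (sup_le_comap h hh hφ ih.1) (sup_le_comap h hh hφs ih.1)⟩

end Comap

/-! ### Directed unions of congruences -/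

section Directed

theorem deltaEps_monotone {ι : Type*} [Preorder ι] {θ θs φ φs : ι → Congruence L A} (hθ : Monotone θ) (hθs : Monotone θs) (hφ : Monotone φ)
    (hφs : Monotone φs) (k : ℕ) :
    Monotone (fun i => (deltaEps (θ i) (θs i) (φ i) (φs i) k).1) ∧
      Monotone (fun i => (deltaEps (θ i) (θs i) (φ i) (φs i) k).2) := by
  induction k with
  | zero => exact ⟨monotone_const, monotone_const⟩
  | succ k ih =>
    exact ⟨(hθ.sup ih.2).inf (hθs.sup ih.2), (hφ.sup ih.1).inf (hφs.sup ih.1)⟩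

variable {ι : Type*} [SemilatticeSup ι] [Nonempty ι]

/-- Operations are finitary, so finitely many related arguments are already related at one common
index; the union is thus a congruence. -/
theorem iSup_r_of_monotone {C : ι → Congruence L A} (hC : Monotone C) {a b : A} :
    (⨆ i, C i).r a b ↔ ∃ i, (C i).r a b := by
  let D : Congruence L A :=
    { r := fun a b => ∃ i, (C i).r a b
      iseqv :=
        ⟨fun a => ⟨Classical.arbitrary ι, refl _ a⟩, fun ⟨i, h⟩ => ⟨i, symm _ h⟩,
          fun ⟨i, h⟩ ⟨j, h'⟩ =>
            ⟨i ⊔ j, trans _ (hC le_sup_left _ _ h) (hC le_sup_right _ _ h')⟩⟩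
      map_rel := fun f _ _ h => by
        choose g hg using h
        obtain ⟨M, hM⟩ := Finite.exists_le g
        exact ⟨M, (C M).map_rel f _ _ fun i => hC (hM i) _ _ (hg i)⟩ }
  constructor
  · intro h
    exact (iSup_le fun i a b hab => ⟨i, hab⟩ : ⨆ i, C i ≤ D) _ _ h
  · rintro ⟨i, h⟩
    exact le_iSup C i _ _ h

theorem iSup_inf_iSup_eq_of_monotone {C D : ι → Congruence L A} (hC : Monotone C)
    (hD : Monotone D) : (⨆ i, C i) ⊓ (⨆ i, D i) = ⨆ i, C i ⊓ D i := by
  apply le_antisymm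
  · rintro a b ⟨h, h'⟩
    obtain ⟨i, hi⟩ := (iSup_r_of_monotone hC).1 h
    obtain ⟨j, hj⟩ := (iSup_r_of_monotone hD).1 h'
    exact le_iSup (fun i => C i ⊓ D i) (i ⊔ j) _ _
      ⟨hC le_sup_left _ _ hi, hD le_sup_right _ _ hj⟩
  · exact iSup_le fun i => inf_le_inf (le_iSup C i) (le_iSup D i)

/-- Joins commute with all suprema and meets with directed ones, so each `δ_k`, `ε_k` is continuous
along directed families. -/
theorem deltaEps_iSup {θ θs φ φs : ι → Congruence L A} (hθ : Monotone θ) (hθs : Monotone θs) (hφ : Monotone φ)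
    (hφs : Monotone φs) (k : ℕ) :
    (deltaEps (⨆ i, θ i) (⨆ i, θs i) (⨆ i, φ i) (⨆ i, φs i) k).1 =
        ⨆ i, (deltaEps (θ i) (θs i) (φ i) (φs i) k).1 ∧
      (deltaEps (⨆ i, θ i) (⨆ i, θs i) (⨆ i, φ i) (⨆ i, φs i) k).2 =
        ⨆ i, (deltaEps (θ i) (θs i) (φ i) (φs i) k).2 := by
  induction k with
  | zero => exact ⟨iSup_const.symm, iSup_const.symm⟩
  | succ k ih =>
    obtain ⟨h₁, h₂⟩ := deltaEps_monotone hθ hθs hφ hφs k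
    simp only [deltaEps, ih.1, ih.2, ← iSup_sup_eq]
    exact ⟨iSup_inf_iSup_eq_of_monotone (hθ.sup h₂) (hθs.sup h₂),
      iSup_inf_iSup_eq_of_monotone (hφ.sup h₁) (hφs.sup h₁)⟩

end Directed

/-! ### The limit of the chains `δ_k`, `ε_k` -/

section Limit

variable (θ θs φ φs : Congruence L A)

theorem deltaEps_le_succ (k : ℕ) :
    (deltaEps θ θs φ φs k).1 ≤ (deltaEps θ θs φ φs (k + 1)).1 ∧
      (deltaEps θ θs φ φs k).2 ≤ (deltaEps θ θs φ φs (k + 1)).2 := by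
  induction k with
  | zero => exact ⟨bot_le, bot_le⟩
  | succ k ih =>
    exact ⟨inf_le_inf (sup_le_sup_left ih.2 _) (sup_le_sup_left ih.2 _),
      inf_le_inf (sup_le_sup_left ih.1 _) (sup_le_sup_left ih.1 _)⟩

theorem monotone_delta : Monotone (delta θ θs φ φs) :=
  monotone_nat_of_le_succ fun k => (deltaEps_le_succ θ θs φ φs k).1

theorem monotone_eps : Monotone fun k => (deltaEps θ θs φ φs k).2 :=
  monotone_nat_of_le_succ fun k => (deltaEps_le_succ θ θs φ φs k).2

/-- The union of the chains `δ_k` and `ε_k`. -/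
def deltaLimit : Congruence L A := ⨆ k, delta θ θs φ φs k

/-- The chains interleave: `δ_k ≤ ε_{k+1}` and `ε_k ≤ δ_{k+1}`. -/
theorem deltaLimit_eq_iSup_eps : deltaLimit θ θs φ φs = ⨆ k, (deltaEps θ θs φ φs k).2 :=
  le_antisymm
    (iSup_le fun k => le_trans (le_inf le_sup_right le_sup_right)
      (le_iSup (fun k => (deltaEps θ θs φ φs k).2) (k + 1)))
    (iSup_le fun k => le_trans (le_inf le_sup_right le_sup_right)
      (le_iSup (delta θ θs φ φs) (k + 1)))

/-- With the limit written as the union of the `ε_k`, the meet passes inside the union and its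
`k`-th member is `δ_{k+1}`. Modulo the limit, `θ` and `θs` therefore intersect trivially. -/
theorem sup_deltaLimit_inf_sup_deltaLimit :
    (θ ⊔ deltaLimit θ θs φ φs) ⊓ (θs ⊔ deltaLimit θ θs φ φs) ≤ deltaLimit θ θs φ φs := by
  have hm := monotone_eps θ θs φ φs
  conv_lhs => rw [deltaLimit_eq_iSup_eps, sup_iSup, sup_iSup]
  refine le_trans (iSup_inf_iSup_eq_of_monotone (C := fun k => θ ⊔ (deltaEps θ θs φ φs k).2)
    (D := fun k => θs ⊔ (deltaEps θ θs φ φs k).2) (monotone_const.sup hm)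
    (monotone_const.sup hm)).le ?_
  exact iSup_le fun k => le_iSup (delta θ θs φ φs) (k + 1)

theorem sup_deltaLimit_inf_sup_deltaLimit' :
    (φ ⊔ deltaLimit θ θs φ φs) ⊓ (φs ⊔ deltaLimit θ θs φ φs) ≤ deltaLimit θ θs φ φs := by
  have hm := monotone_delta θ θs φ φs
  conv_rhs => rw [deltaLimit_eq_iSup_eps]
  rw [deltaLimit, sup_iSup, sup_iSup]
  refine le_trans (iSup_inf_iSup_eq_of_monotone (C := fun k => φ ⊔ delta θ θs φ φs k)
    (D := fun k => φs ⊔ delta θ θs φ φs k) (monotone_const.sup hm) (monotone_const.sup hm)).le ?_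
  exact iSup_le fun k => le_iSup (fun k => (deltaEps θ θs φ φs k).2) (k + 1)

theorem inf_le_deltaLimit : θ ⊓ θs ≤ deltaLimit θ θs φ φs :=
  le_trans (inf_le_inf le_sup_left le_sup_left)
    (sup_deltaLimit_inf_sup_deltaLimit θ θs φ φs)

theorem exists_sup_delta_of_sup_deltaLimit {ψ : Congruence L A} {a b : A}
    (h : (ψ ⊔ deltaLimit θ θs φ φs).r a b) : ∃ k, (ψ ⊔ delta θ θs φ φs k).r a b := by
  rw [deltaLimit, sup_iSup] at h
  exact (iSup_r_of_monotone (monotone_const.sup (monotone_delta θ θs φ φs))).1 h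

variable {θ θs φ φs}

theorem delta_eq_bot (h : θ ⊓ θs = ⊥) (h' : φ ⊓ φs = ⊥) (k : ℕ) :
    delta θ θs φ φs k = ⊥ := by
  suffices H : deltaEps θ θs φ φs k = (⊥, ⊥) from congrArg Prod.fst H
  induction k with
  | zero => rfl
  | succ k ih => simp [deltaEps, ih, h, h']

end Limit

/-! ### Quotient algebras and complementary pairs -/

/-- The quotient algebra. -/
abbrev Quo (θ : Congruence L A) : Type _ := Quotient θ.toSetoid

/-- The choice of representatives is harmless by `mk_funMap`; relation symbols play no role. -/
noncomputable instance (θ : Congruence L A) : L.Structure (Quo θ) where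
  funMap f a := Quotient.mk _ (Structure.funMap f fun i => (a i).out)
  RelMap _ _ := False

theorem mk_funMap (θ : Congruence L A) {m : ℕ} (f : L.Functions m) (a : Fin m → A) :
    (Quotient.mk θ.toSetoid (Structure.funMap f a) : Quo θ) =
      Structure.funMap f fun i => (Quotient.mk θ.toSetoid (a i) : Quo θ) :=
  Quotient.sound (θ.map_rel f _ _ fun i => θ.symm (Quotient.mk_out (s := θ.toSetoid) (a i)))

theorem satisfies_quo {E : Identities L} {θ : Congruence L A}
    (h : ∀ e ∈ E, ∀ a : ℕ → A, θ.r (e.1.realize a) (e.2.realize a)) : Satisfies E (Quo θ) := by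
  intro e he a
  have ha : a = fun i => Quotient.mk θ.toSetoid (a i).out := funext fun i => (a i).out_eq.symm
  rw [ha, ← realize_comp_of_map_funMap (fun a => (Quotient.mk θ.toSetoid a : Quo θ)) θ.mk_funMap,
    ← realize_comp_of_map_funMap (fun a => (Quotient.mk θ.toSetoid a : Quo θ)) θ.mk_funMap]
  exact Quotient.sound (h e he _)

/-- The image in `A / θ` of a congruence above `θ`. -/
def mapQuo {θ φ : Congruence L A} (h : θ ≤ φ) : Congruence L (Quo θ) where
  r a b := φ.r a.out b.out
  iseqv := ⟨fun _ => φ.refl _, φ.symm, φ.trans⟩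
  map_rel f _ _ hab :=
    φ.trans (h _ _ (Quotient.mk_out (s := θ.toSetoid) _))
      (φ.trans (φ.map_rel f _ _ hab) (φ.symm (h _ _ (Quotient.mk_out (s := θ.toSetoid) _))))

theorem mapQuo_r {θ φ : Congruence L A} (h : θ ≤ φ) {a b : A} :
    (mapQuo h).r (Quotient.mk θ.toSetoid a) (Quotient.mk θ.toSetoid b) ↔ φ.r a b := by
  have ha := h _ _ (Quotient.mk_out (s := θ.toSetoid) a)
  have hb := h _ _ (Quotient.mk_out (s := θ.toSetoid) b)
  exact ⟨fun H => φ.trans (φ.symm ha) (φ.trans H hb),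
    fun H => φ.trans ha (φ.trans H (φ.symm hb))⟩

theorem complementary_mapQuo {θ φ φs : Congruence L A} (h : θ ≤ φ) (hs : θ ≤ φs)
    (hinf : φ ⊓ φs ≤ θ) (hcomp : ∀ a b, ∃ c, φ.r a c ∧ φs.r c b) :
    Complementary (mapQuo h) (mapQuo hs) := by
  constructor
  · apply le_bot_iff.1
    intro a b
    refine Quotient.inductionOn₂ a b fun a b hab => ?_
    exact Quotient.sound (hinf _ _ ⟨(mapQuo_r h).1 hab.1, (mapQuo_r hs).1 hab.2⟩)
  · intro a b
    refine Quotient.inductionOn₂ a b fun a b => ?_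
    obtain ⟨c, h₁, h₂⟩ := hcomp a b
    exact ⟨Quotient.mk _ c, (mapQuo_r h).2 h₁, (mapQuo_r hs).2 h₂⟩

theorem Complementary.symm {θ θs : Congruence L A} (h : Complementary θ θs) :
    Complementary θs θ := by
  refine ⟨inf_comm θ θs ▸ h.1, fun a b => ?_⟩
  obtain ⟨c, h₁, h₂⟩ := h.2 b a
  exact ⟨c, Congruence.symm _ h₂, Congruence.symm _ h₁⟩

theorem Complementary.eq {θ θs : Congruence L A} (h : Complementary θ θs) {a b : A}
    (h₁ : θ.r a b) (h₂ : θs.r a b) : a = b := by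
  have : (θ ⊓ θs).r a b := ⟨h₁, h₂⟩
  rw [h.1] at this
  exact this

end Basic

/-! ### From the rectangle property to a distributive sublattice -/

section Transfer

variable {L : FirstOrder.Language.{u, v}} {A : Type*} [L.Structure A]

/-- Every factor congruence is a product congruence with respect to every decomposition of `A`
into two factors. -/
def FactorsDecompose (L : FirstOrder.Language.{u, v}) (A : Type*) [L.Structure A] : Prop :=
  ∀ θ θs φ : Congruence L A, Complementary θ θs → φ ∈ factorCongruences L A →
    ∀ x y z w : A, θs.r x y → θ.r x z → θ.r y w → φ.r z w → φ.r x y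

/-- Factor congruences permute: given `a φ c θ b`, choose `d` with `a θ d θs b`; the rectangle moves
`φ` from `(a, c)` to `(d, b)`. Hence `θ ∘ φ` is already the join. -/
theorem FactorsDecompose.sup_r (H : FactorsDecompose L A) {θ φ : Congruence L A}
    (hθ : θ ∈ factorCongruences L A) (hφ : φ ∈ factorCongruences L A) {a b : A} :
    (θ ⊔ φ).r a b ↔ ∃ c, θ.r a c ∧ φ.r c b := by
  obtain ⟨θs, hθs⟩ := hθ
  have swap : ∀ {a b : A}, (∃ c, φ.r a c ∧ θ.r c b) → ∃ c, θ.r a c ∧ φ.r c b := by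
    rintro a b ⟨c, hac, hcb⟩
    obtain ⟨d, had, hdb⟩ := hθs.2 a b
    exact ⟨d, had, H θ θs φ hθs hφ d b a c hdb (θ.symm had) (θ.symm hcb) hac⟩
  let D : Congruence L A :=
    { r := fun a b => ∃ c, θ.r a c ∧ φ.r c b
      iseqv :=
        ⟨fun a => ⟨a, θ.refl a, φ.refl a⟩,
          fun ⟨c, h, h'⟩ => swap ⟨c, φ.symm h', θ.symm h⟩,
          fun ⟨c, h₁, h₂⟩ ⟨d, h₃, h₄⟩ => by
            obtain ⟨e, h₅, h₆⟩ := swap ⟨_, h₂, h₃⟩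
            exact ⟨e, θ.trans h₁ h₅, φ.trans h₆ h₄⟩⟩
      map_rel := fun f _ _ h => by
        choose c hc hc' using h
        exact ⟨_, θ.map_rel f _ _ hc, φ.map_rel f _ _ hc'⟩ }
  constructor
  · intro h
    have : θ ⊔ φ ≤ D :=
      sup_le (fun a b hab => ⟨b, hab, φ.refl b⟩) (fun a b hab => ⟨a, θ.refl a, hab⟩)
    exact this _ _ h
  · rintro ⟨c, h, h'⟩
    exact (θ ⊔ φ).trans ((le_sup_left : θ ≤ θ ⊔ φ) _ _ h) ((le_sup_right : φ ≤ θ ⊔ φ) _ _ h')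

/-- Both halves use rectangles with one degenerate side. The same statement for the complements
gives closure under meets. -/
theorem FactorsDecompose.complementary_sup_inf (H : FactorsDecompose L A)
    {θ θs φ φs : Congruence L A} (hθ : Complementary θ θs) (hφ : Complementary φ φs) :
    Complementary (θ ⊔ φ) (θs ⊓ φs) := by
  have hsup := @FactorsDecompose.sup_r L A _ H θ φ ⟨θs, hθ⟩ ⟨φs, hφ⟩
  constructor
  · apply le_bot_iff.1
    rintro a b ⟨h, h₁, h₂⟩
    obtain ⟨c, hac, hcb⟩ := hsup.1 h
    exact hφ.eq (H θ θs φ hθ ⟨φs, hφ⟩ a b c b h₁ hac (θ.refl b) hcb) h₂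
  · intro a b
    obtain ⟨c, hac, hcb⟩ := hθ.2 a b
    obtain ⟨d, hcd, hdb⟩ := hφ.2 c b
    exact ⟨d, hsup.2 ⟨c, hac, hcd⟩,
      H φ φs θs hφ ⟨θ, hθ.symm⟩ d b c b hdb (φ.symm hcd) (φ.refl b) hcb, hdb⟩

theorem FactorsDecompose.isSublattice (H : FactorsDecompose L A) :
    IsSublattice (factorCongruences L A) :=
  ⟨fun _ ⟨_, hθ⟩ _ ⟨_, hφ⟩ => ⟨_, H.complementary_sup_inf hθ hφ⟩,
    fun _ ⟨_, hθ⟩ _ ⟨_, hφ⟩ => ⟨_, (H.complementary_sup_inf hθ.symm hφ.symm).symm⟩⟩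

theorem FactorsDecompose.inf_sup_left (H : FactorsDecompose L A) {θ φ ψ : Congruence L A}
    (hθ : θ ∈ factorCongruences L A) (hφ : φ ∈ factorCongruences L A)
    (hψ : ψ ∈ factorCongruences L A) : θ ⊓ (φ ⊔ ψ) = (θ ⊓ φ) ⊔ (θ ⊓ ψ) := by
  refine le_antisymm ?_ le_inf_sup
  rintro a b ⟨hab, h⟩
  obtain ⟨θs, hθs⟩ := hθ
  obtain ⟨c, hac, hcb⟩ := (H.sup_r hφ hψ).1 h
  obtain ⟨d, had, hdc⟩ := hθs.2 a c
  have hbd : θ.r d b := θ.trans (θ.symm had) hab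
  -- Here `d` is the projection of `c` to the `θ`-class of `a` and `b` along `θs`; the path `a φ c ψ
  -- b` projects to `a φ d ψ b`.
  have h₁ : (θ ⊓ φ).r a d := ⟨had, H θs θ φ hθs.symm hφ a d a c had (θs.refl a) hdc hac⟩
  have h₂ : (θ ⊓ ψ).r d b := ⟨hbd, H θs θ ψ hθs.symm hψ d b c b hbd hdc (θs.refl b) hcb⟩
  exact Congruence.trans _ ((le_sup_left : _ ≤ (θ ⊓ φ) ⊔ (θ ⊓ ψ)) _ _ h₁)
    ((le_sup_right : _ ≤ (θ ⊓ φ) ⊔ (θ ⊓ ψ)) _ _ h₂)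

end Transfer

end Congruence

/-! ### The term conditions as a solvable system of congruence equations -/

section Equations

variable {L : FirstOrder.Language.{u, v}} {A : Type*} [L.Structure A] {n : ℕ}

open Congruence

/-- The conditions `Cg(X, σ X) ⊆ θ`, `Cg(X, σ* X) ⊆ θs`, `Cg(X, ρ X) ⊆ φ`, `Cg(X, ρ* X) ⊆ φs`
as a system of congruence equations in the unknowns `x, y, z, w, x_j, y_j`. -/
structure IsSolution (s t : (j : Fin n) → L.Term (Var j)) (θ θs φ φs : Congruence L A)
    (X : Var n → A) : Prop where
  z_x : θ.r (X .z) (X .x)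
  w_y : θ.r (X .w) (X .y)
  y_x : θs.r (X .y) (X .x)
  w_z : φ.r (X .w) (X .z)
  xs_s (j : Fin n) : θ.r (X (.xs j)) ((s j).realize fun p : Var (j : ℕ) => X (p.lift j.isLt.le))
  xs_t (j : Fin n) : θs.r (X (.xs j)) ((t j).realize fun p : Var (j : ℕ) => X (p.lift j.isLt.le))
  ys_s (j : Fin n) : φ.r (X (.ys j)) ((s j).realize fun p : Var (j : ℕ) => X (p.lift j.isLt.le))
  ys_t (j : Fin n) : φs.r (X (.ys j)) ((t j).realize fun p : Var (j : ℕ) => X (p.lift j.isLt.le))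

variable {s t : (j : Fin n) → L.Term (Var j)} {θ θs φ φs : Congruence L A} {X : Var n → A}

/-- The entries of `X` and of the transformed tuple are congruent, so each term may be evaluated at
`X` itself, which removes the recursion. -/
theorem isSolution_of_Cg_le (hθ : Cg L X (sigma s X) ≤ θ) (hθs : Cg L X (sigmaStar t X) ≤ θs)
    (hφ : Cg L X (rho s X) ≤ φ) (hφs : Cg L X (rhoStar t X) ≤ φs) :
    IsSolution s t θ θs φ φs X where
  z_x := by simpa only [sigma] using r_of_Cg_le hθ .z
  w_y := by simpa only [sigma] using r_of_Cg_le hθ .w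
  y_x := by simpa only [sigmaStar] using r_of_Cg_le hθs .y
  w_z := by simpa only [rho] using r_of_Cg_le hφ .w
  xs_s j := by
    have h := r_of_Cg_le hθ (.xs j)
    rw [sigma] at h
    exact θ.trans h (θ.symm (θ.realize_r _ fun p => r_of_Cg_le hθ _))
  xs_t j := by
    have h := r_of_Cg_le hθs (.xs j)
    rw [sigmaStar] at h
    exact θs.trans h (θs.symm (θs.realize_r _ fun p => r_of_Cg_le hθs _))
  ys_s j := by
    have h := r_of_Cg_le hφ (.ys j)
    rw [rho] at h
    exact φ.trans h (φ.symm (φ.realize_r _ fun p => r_of_Cg_le hφ _))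
  ys_t j := by
    have h := r_of_Cg_le hφs (.ys j)
    rw [rhoStar] at h
    exact φs.trans h (φs.symm (φs.realize_r _ fun p => r_of_Cg_le hφs _))

/-- Induction on the stage restores the recursion: the arguments of each term are already known to
be congruent. -/
theorem IsSolution.Cg_sigma_le (h : IsSolution s t θ θs φ φs X) : Cg L X (sigma s X) ≤ θ := by
  refine Cg_le fun p => ?_
  induction hk : p.stage using Nat.strong_induction_on generalizing p with
  | _ k ih =>
    cases p with
    | x => rw [sigma]
    | y => rw [sigma]
    | z => rw [sigma]; exact h.z_x
    | w => rw [sigma]; exact h.w_y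
    | ys j => rw [sigma]
    | xs j =>
      rw [sigma]
      refine θ.trans (h.xs_s j) (θ.realize_r _ fun p => ih _ ?_ _ rfl)
      rw [← hk]
      exact Var.stage_lift_lt j p

theorem IsSolution.Cg_sigmaStar_le (h : IsSolution s t θ θs φ φs X) :
    Cg L X (sigmaStar t X) ≤ θs := by
  refine Cg_le fun p => ?_
  induction hk : p.stage using Nat.strong_induction_on generalizing p with
  | _ k ih =>
    cases p with
    | x => rw [sigmaStar]
    | y => rw [sigmaStar]; exact h.y_x
    | z => rw [sigmaStar]
    | w => rw [sigmaStar]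
    | ys j => rw [sigmaStar]
    | xs j =>
      rw [sigmaStar]
      refine θs.trans (h.xs_t j) (θs.realize_r _ fun p => ih _ ?_ _ rfl)
      rw [← hk]
      exact Var.stage_lift_lt j p

theorem IsSolution.Cg_rho_le (h : IsSolution s t θ θs φ φs X) : Cg L X (rho s X) ≤ φ := by
  refine Cg_le fun p => ?_
  induction hk : p.stage using Nat.strong_induction_on generalizing p with
  | _ k ih =>
    cases p with
    | x => rw [rho]
    | y => rw [rho]
    | z => rw [rho]
    | w => rw [rho]; exact h.w_z
    | xs j => rw [rho]
    | ys j =>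
      rw [rho]
      refine φ.trans (h.ys_s j) (φ.realize_r _ fun p => ih _ ?_ _ rfl)
      rw [← hk]
      exact Var.stage_lift_lt j p

theorem IsSolution.Cg_rhoStar_le (h : IsSolution s t θ θs φ φs X) :
    Cg L X (rhoStar t X) ≤ φs := by
  refine Cg_le fun p => ?_
  induction hk : p.stage using Nat.strong_induction_on generalizing p with
  | _ k ih =>
    cases p with
    | x => rw [rhoStar]
    | y => rw [rhoStar]
    | z => rw [rhoStar]
    | w => rw [rhoStar]
    | xs j => rw [rhoStar]
    | ys j =>
      rw [rhoStar]
      refine φs.trans (h.ys_t j) (φs.realize_r _ fun p => ih _ ?_ _ rfl)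
      rw [← hk]
      exact Var.stage_lift_lt j p

/-- The tuple `x, y, z, w, x_1, y_1, …` whose last entries are read off a sequence of pairs. -/
def tuple (x y z w : A) (c : ℕ → A × A) (n : ℕ) : Var n → A
  | .x => x
  | .y => y
  | .z => z
  | .w => w
  | .xs i => (c i).1
  | .ys i => (c i).2

theorem tuple_lift (x y z w : A) (c : ℕ → A × A) {m n : ℕ} (h : m ≤ n) (p : Var m) :
    tuple x y z w c n (p.lift h) = tuple x y z w c m p := by
  cases p <;> rfl

theorem tuple_congr (x y z w : A) {c d : ℕ → A × A} {n : ℕ} (h : ∀ i < n, c i = d i) :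
    tuple x y z w c n = tuple x y z w d n := by
  funext p
  cases p with
  | xs i => simp only [tuple, h i i.isLt]
  | ys i => simp only [tuple, h i i.isLt]
  | _ => rfl

/-- Course-of-values choice: `P n` sees only the first `n` entries of the sequence. -/
theorem exists_sequence (P : (n : ℕ) → (ℕ → A × A) → A × A → Prop)
    (hP : ∀ n c d q, (∀ i < n, c i = d i) → P n c q → P n d q) (hex : ∀ n c, ∃ q, P n c q)
    [Nonempty A] : ∃ c : ℕ → A × A, ∀ n, P n c (c n) := by
  choose g hg using hex
  let a : A := Classical.arbitrary A
  let c : ℕ → A × A := Nat.strongRec fun n ih => g n fun i => if h : i < n then ih i h else (a, a)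
  refine ⟨c, fun n => ?_⟩
  -- The padding `(a, a)` from index `n` on is invisible to `P n`.
  have hc : c n = g n fun i => if i < n then c i else (a, a) := by
    simp only [c]
    rw [Nat.strongRec]
    rfl
  rw [hc]
  refine hP n _ c _ (fun i hi => ?_) (hg n _)
  simp [hi]

/-- Complementary factor congruences allow one to solve the system step by step. -/
theorem exists_isSolution (s t : (j : Fin n) → L.Term (Var j)) (hθ : Complementary θ θs)
    (hφ : Complementary φ φs) {x y z w : A} (hzx : θ.r z x) (hwy : θ.r w y) (hyx : θs.r y x)
    (hwz : φ.r w z) :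
    ∃ X : Var n → A, IsSolution s t θ θs φ φs X ∧ X .x = x ∧ X .y = y := by
  have : Nonempty A := ⟨x⟩
  obtain ⟨c, hc⟩ := exists_sequence (A := A)
    (fun m c q => ∀ h : m < n,
      (θ.r q.1 ((s ⟨m, h⟩).realize (tuple x y z w c m)) ∧
        θs.r q.1 ((t ⟨m, h⟩).realize (tuple x y z w c m))) ∧
      φ.r q.2 ((s ⟨m, h⟩).realize (tuple x y z w c m)) ∧
        φs.r q.2 ((t ⟨m, h⟩).realize (tuple x y z w c m)))
    (fun m c d q hcd hq => by rwa [← tuple_congr x y z w hcd])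
    (fun m c => by
      by_cases h : m < n
      -- The new entries are intermediate points for `θ ∘ θs` and `φ ∘ φs` between the values of the
      -- two terms.
      · obtain ⟨a, ha⟩ := hθ.2 ((s ⟨m, h⟩).realize (tuple x y z w c m))
          ((t ⟨m, h⟩).realize (tuple x y z w c m))
        obtain ⟨b, hb⟩ := hφ.2 ((s ⟨m, h⟩).realize (tuple x y z w c m))
          ((t ⟨m, h⟩).realize (tuple x y z w c m))
        exact ⟨(a, b), fun _ => ⟨⟨θ.symm ha.1, ha.2⟩, φ.symm hb.1, hb.2⟩⟩
      · exact ⟨(x, x), fun h' => absurd h' h⟩)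
  have hl : ∀ j : Fin n, (fun p : Var (j : ℕ) => tuple x y z w c n (p.lift j.isLt.le)) =
      tuple x y z w c j := fun j => funext fun p => tuple_lift x y z w c _ p
  refine ⟨tuple x y z w c n, ⟨hzx, hwy, hyx, hwz, fun j => ?_, fun j => ?_, fun j => ?_,
    fun j => ?_⟩, rfl, rfl⟩
  · rw [hl]; exact (hc j j.isLt).1.1
  · rw [hl]; exact (hc j j.isLt).1.2
  · rw [hl]; exact (hc j j.isLt).2.1
  · rw [hl]; exact (hc j j.isLt).2.2

end Equations

/-! ### The free algebra with formal witnesses, and good lists of pairs -/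

/-- The absolutely free algebra over `x, y, z, w` in which any two elements `s`, `t` have formal
witnesses `X s t` and `Y s t`. -/
inductive WitnessTerm (L : FirstOrder.Language.{u, v}) : Type (max u w)
  | x : WitnessTerm L
  | y : WitnessTerm L
  | z : WitnessTerm L
  | w : WitnessTerm L
  | X (s t : WitnessTerm L) : WitnessTerm L
  | Y (s t : WitnessTerm L) : WitnessTerm L
  | func {m : ℕ} (f : L.Functions m) (a : Fin m → WitnessTerm L) : WitnessTerm L

namespace WitnessTerm

variable {L : FirstOrder.Language.{u, v}}

instance : Nonempty (WitnessTerm.{u, v, w} L) := ⟨x⟩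

instance : L.Structure (WitnessTerm.{u, v, w} L) where
  funMap f a := func f a
  RelMap _ _ := False

/-- The tuple of generators determined by a sequence of pairs of elements. -/
def gens (p : ℕ → WitnessTerm.{u, v, w} L × WitnessTerm.{u, v, w} L) (n : ℕ) :
    Var n → WitnessTerm.{u, v, w} L :=
  tuple x y z w (fun i => (X (p i).1 (p i).2, Y (p i).1 (p i).2)) n

/-- The element `a` is a term in the first generators. -/
def Reach (p : ℕ → WitnessTerm.{u, v, w} L × WitnessTerm.{u, v, w} L) (n : ℕ)
    (a : WitnessTerm.{u, v, w} L) : Prop :=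
  ∃ s : L.Term (Var n), s.realize (gens p n) = a

/-- The first `n` pairs are distinct, and each consists of terms in the preceding generators. -/
def Good (p : ℕ → WitnessTerm.{u, v, w} L × WitnessTerm.{u, v, w} L) (n : ℕ) : Prop :=
  (∀ i < n, ∀ j < n, p i = p j → i = j) ∧ ∀ j < n, Reach p j (p j).1 ∧ Reach p j (p j).2

/-- The list `(q, n)` prolongs the list `(p, m)`. -/
def Extends (p : ℕ → WitnessTerm.{u, v, w} L × WitnessTerm.{u, v, w} L) (m : ℕ)
    (q : ℕ → WitnessTerm.{u, v, w} L × WitnessTerm.{u, v, w} L) (n : ℕ) : Prop :=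
  m ≤ n ∧ ∀ i < m, q i = p i

variable {p q r : ℕ → WitnessTerm.{u, v, w} L × WitnessTerm.{u, v, w} L} {k m n : ℕ}

theorem Extends.rfl : Extends p m p m := ⟨le_rfl, fun _ _ => Eq.refl _⟩

theorem Extends.trans (h : Extends p k q m) (h' : Extends q m r n) : Extends p k r n :=
  ⟨h.1.trans h'.1, fun i hi => (h'.2 i (hi.trans_le h.1)).trans (h.2 i hi)⟩

theorem Reach.mono (h : Extends p m q n) {a : WitnessTerm.{u, v, w} L} (ha : Reach p m a) :
    Reach q n a := by
  obtain ⟨s, rfl⟩ := ha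
  refine ⟨s.relabel (Var.lift h.1), ?_⟩
  rw [Term.realize_relabel]
  congr 1
  funext v
  rw [Function.comp_apply, gens, tuple_lift, gens]
  exact congrFun (tuple_congr _ _ _ _ fun i hi => by simp only [h.2 i hi]) v

/-- The pair is appended only when absent, which keeps the list free of repetitions. -/
theorem Good.exists_extends_mem (hp : Good p m) {b : WitnessTerm.{u, v, w} L ×
    WitnessTerm.{u, v, w} L} (h₁ : Reach p m b.1) (h₂ : Reach p m b.2) :
    ∃ q n, Good q n ∧ Extends p m q n ∧ ∃ i < n, q i = b := by
  by_cases hb : ∃ i < m, p i = b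
  · exact ⟨p, m, hp, .rfl, hb⟩
  have hlt : ∀ i < m, Function.update p m b i = p i := fun i hi =>
    Function.update_of_ne hi.ne b p
  have hm : Function.update p m b m = b := Function.update_self m b p
  have hE : ∀ i ≤ m, Extends p i (Function.update p m b) i := fun i hi =>
    ⟨le_rfl, fun j hj => hlt j (hj.trans_le hi)⟩
  refine ⟨Function.update p m b, m + 1, ⟨fun i hi j hj hij => ?_, fun j hj => ?_⟩,
    ⟨m.le_succ, hlt⟩, m, m.lt_succ_self, hm⟩
  · rcases Nat.lt_succ_iff_lt_or_eq.1 hi with hi | rfl <;>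
      rcases Nat.lt_succ_iff_lt_or_eq.1 hj with hj | rfl
    · rw [hlt i hi, hlt j hj] at hij
      exact hp.1 i hi j hj hij
    · rw [hlt i hi, hm] at hij
      exact absurd ⟨i, hi, hij⟩ hb
    · rw [hlt j hj, hm] at hij
      exact absurd ⟨j, hj, hij.symm⟩ hb
    · rfl
  · rcases Nat.lt_succ_iff_lt_or_eq.1 hj with hj | rfl
    · rw [hlt j hj]
      exact ⟨(hp.2 j hj).1.mono (hE j hj.le), (hp.2 j hj).2.mono (hE j hj.le)⟩
    · rw [hm]
      exact ⟨h₁.mono (hE j le_rfl), h₂.mono (hE j le_rfl)⟩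

/-- Properties that survive prolongation can be achieved one after another. This serves the
arguments of an operation and the finite set of pairs. -/
theorem Good.exists_extends_forall {ι : Type*} [Finite ι]
    (Q : ι → (ℕ → WitnessTerm.{u, v, w} L × WitnessTerm.{u, v, w} L) → ℕ → Prop)
    (hmono : ∀ i p m q n, Extends p m q n → Q i p m → Q i q n)
    (hQ : ∀ i p m, Good p m → ∃ q n, Good q n ∧ Extends p m q n ∧ Q i q n) (hp : Good p m) :
    ∃ q n, Good q n ∧ Extends p m q n ∧ ∀ i, Q i q n := by
  suffices ∀ S : Set ι, S.Finite →
      ∃ q n, Good q n ∧ Extends p m q n ∧ ∀ i ∈ S, Q i q n by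
    simpa using this Set.univ Set.finite_univ
  intro S hS
  induction S, hS using Set.Finite.induction_on with
  | empty => exact ⟨p, m, hp, .rfl, by simp⟩
  | @insert a S _ _ ih =>
    obtain ⟨q, n, hq, hpq, hS⟩ := ih
    obtain ⟨r, k, hr, hqr, ha⟩ := hQ a q n hq
    refine ⟨r, k, hr, hpq.trans hqr, ?_⟩
    rintro i (rfl | hi)
    · exact ha
    · exact hmono i _ _ _ _ hqr (hS i hi)

theorem Good.exists_extends_reach_and_mem
    {a b : WitnessTerm.{u, v, w} L}
    (ha : ∀ p m, Good p m → ∃ q n, Good q n ∧ Extends p m q n ∧ Reach q n a)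
    (hb : ∀ p m, Good p m → ∃ q n, Good q n ∧ Extends p m q n ∧ Reach q n b)
    (hp : Good p m) : ∃ q n, Good q n ∧ Extends p m q n ∧ ∃ i < n, q i = (a, b) := by
  obtain ⟨q, n, hq, hpq, hqa⟩ := ha p m hp
  obtain ⟨r, k, hr, hqr, hrb⟩ := hb q n hq
  obtain ⟨s, l, hs, hrs, h⟩ := hr.exists_extends_mem (b := (a, b)) (hqa.mono hqr) hrb
  exact ⟨s, l, hs, hpq.trans (hqr.trans hrs), h⟩

/-- To reach `X s t` or `Y s t`, first reach `s` and `t`, then list the pair `(s, t)`. Starting from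
an arbitrary good list lets the inductive steps be chained. -/
theorem Good.exists_extends_reach (a : WitnessTerm.{u, v, w} L) :
    ∀ p m, Good p m → ∃ q n, Good q n ∧ Extends p m q n ∧ Reach q n a := by
  induction a with
  | x => exact fun p m hp => ⟨p, m, hp, .rfl, Term.var .x, rfl⟩
  | y => exact fun p m hp => ⟨p, m, hp, .rfl, Term.var .y, rfl⟩
  | z => exact fun p m hp => ⟨p, m, hp, .rfl, Term.var .z, rfl⟩
  | w => exact fun p m hp => ⟨p, m, hp, .rfl, Term.var .w, rfl⟩
  | X s t hs ht =>
    intro p m hp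
    obtain ⟨q, n, hq, hpq, i, hi, hqi⟩ := hp.exists_extends_reach_and_mem hs ht
    refine ⟨q, n, hq, hpq, Term.var (.xs ⟨i, hi⟩), ?_⟩
    simp [gens, tuple, hqi]
  | Y s t hs ht =>
    intro p m hp
    obtain ⟨q, n, hq, hpq, i, hi, hqi⟩ := hp.exists_extends_reach_and_mem hs ht
    refine ⟨q, n, hq, hpq, Term.var (.ys ⟨i, hi⟩), ?_⟩
    simp [gens, tuple, hqi]
  | func f a ih =>
    intro p m hp
    obtain ⟨q, n, hq, hpq, h⟩ := hp.exists_extends_forall (fun i q n => Reach q n (a i))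
      (fun _ _ _ _ _ h ha => ha.mono h) ih
    choose s hs using h
    refine ⟨q, n, hq, hpq, Term.func f s, ?_⟩
    simp only [Term.realize, hs]
    rfl

theorem exists_good (S : Finset (WitnessTerm.{u, v, w} L × WitnessTerm.{u, v, w} L)) :
    ∃ p n, Good p n ∧ ∀ b ∈ S, ∃ i < n, p i = b := by
  have h0 : Good (fun _ => ((x : WitnessTerm.{u, v, w} L), x)) 0 :=
    ⟨fun i hi => absurd hi i.not_lt_zero, fun i hi => absurd hi i.not_lt_zero⟩
  obtain ⟨q, n, hq, -, h⟩ := h0.exists_extends_forall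
    (fun (b : S) q n => ∃ i < n, q i = b.1)
    (fun b p m q n h ⟨i, hi, hb⟩ => ⟨i, hi.trans_le h.1, (h.2 i hi).trans hb⟩)
    (fun b p m hp => hp.exists_extends_reach_and_mem (Good.exists_extends_reach b.1.1)
      (Good.exists_extends_reach b.1.2))
  exact ⟨q, n, hq, fun b hb => h ⟨b, hb⟩⟩

/-! ### Evaluation of the generic algebra -/

open Classical in
/-- The homomorphism extending a valuation of the first generators. -/
noncomputable def eval {A : Type*} [L.Structure A]
    (p : ℕ → WitnessTerm.{u, v, w} L × WitnessTerm.{u, v, w} L) (a : Var n → A) :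
    WitnessTerm.{u, v, w} L → A
  | x => a .x
  | y => a .y
  | z => a .z
  | w => a .w
  -- Witnesses of unlisted pairs get an arbitrary value; terms in the listed generators never meet
  -- it.
  | X s t => if h : ∃ i : Fin n, p i = (s, t) then a (.xs h.choose) else a .x
  | Y s t => if h : ∃ i : Fin n, p i = (s, t) then a (.ys h.choose) else a .x
  | func f b => Structure.funMap f fun i => eval p a (b i)

section Eval

variable {A : Type*} [L.Structure A]

theorem eval_funMap (p : ℕ → WitnessTerm.{u, v, w} L × WitnessTerm.{u, v, w} L) (a : Var n → A)
    {m : ℕ} (f : L.Functions m) (b : Fin m → WitnessTerm.{u, v, w} L) :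
    eval p a (Structure.funMap f b) = Structure.funMap f fun i => eval p a (b i) := rfl

theorem eval_gens (hp : Good p n) (a : Var n → A) (v : Var n) : eval p a (gens p n v) = a v := by
  -- Distinctness of the listed pairs forces the chosen index to be `i`.
  have key : ∀ i : Fin n, ∃ h : ∃ j : Fin n, p j = ((p i).1, (p i).2), h.choose = i := fun i =>
    ⟨⟨i, rfl⟩, Fin.ext (hp.1 _ (Fin.isLt _) _ i.isLt
      (Exists.choose_spec (⟨i, rfl⟩ : ∃ j : Fin n, p j = ((p i).1, (p i).2))))⟩
  cases v with
  | xs i =>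
    obtain ⟨h, hi⟩ := key i
    simp only [gens, tuple, eval]
    rw [dif_pos h, hi]
  | ys i =>
    obtain ⟨h, hi⟩ := key i
    simp only [gens, tuple, eval]
    rw [dif_pos h, hi]
  | _ => rfl

theorem eval_realize (hp : Good p n) (a : Var n → A) (hm : m ≤ n) (s : L.Term (Var m)) :
    eval p a (s.realize (gens p m)) = s.realize fun v => a (v.lift hm) := by
  rw [realize_comp_of_map_funMap (eval p a) (eval_funMap p a)]
  congr 1
  funext v
  rw [← eval_gens hp a (v.lift hm)]
  congr 1
  exact (tuple_lift _ _ _ _ _ hm v).symm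

end Eval

/-! ### The generic congruences and compactness -/

/-- The congruence generated by the identities in `E`, the pairs in `B`, and the pairs
`(c b, π b)` for `b ∈ S`. -/
def generated (E : Identities L) (B : WitnessTerm.{u, v, w} L → WitnessTerm.{u, v, w} L → Prop)
    (c π : WitnessTerm.{u, v, w} L × WitnessTerm.{u, v, w} L → WitnessTerm.{u, v, w} L)
    (S : Set (WitnessTerm.{u, v, w} L × WitnessTerm.{u, v, w} L)) :
    Congruence L (WitnessTerm.{u, v, w} L) :=
  sInf {θ | (∀ e ∈ E, ∀ a : ℕ → WitnessTerm.{u, v, w} L,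
    θ.r (e.1.realize a) (e.2.realize a)) ∧ (∀ a b, B a b → θ.r a b) ∧ ∀ b ∈ S, θ.r (c b) (π b)}

section Generated

variable (E : Identities L) (B : WitnessTerm.{u, v, w} L → WitnessTerm.{u, v, w} L → Prop)
  (c π : WitnessTerm.{u, v, w} L × WitnessTerm.{u, v, w} L → WitnessTerm.{u, v, w} L)

theorem generated_identity (S : Set (WitnessTerm.{u, v, w} L × WitnessTerm.{u, v, w} L)) :
    ∀ e ∈ E, ∀ a : ℕ → WitnessTerm.{u, v, w} L,
      (generated E B c π S).r (e.1.realize a) (e.2.realize a) :=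
  fun e he a _ h => h.1 e he a

theorem generated_base (S : Set (WitnessTerm.{u, v, w} L × WitnessTerm.{u, v, w} L))
    {a b : WitnessTerm.{u, v, w} L} (hab : B a b) : (generated E B c π S).r a b :=
  fun _ h => h.2.1 a b hab

theorem generated_witness {S : Set (WitnessTerm.{u, v, w} L × WitnessTerm.{u, v, w} L)}
    {b : WitnessTerm.{u, v, w} L × WitnessTerm.{u, v, w} L} (hb : b ∈ S) :
    (generated E B c π S).r (c b) (π b) :=
  fun _ h => h.2.2 b hb

theorem generated_monotone :
    Monotone fun S : Finset (WitnessTerm.{u, v, w} L × WitnessTerm.{u, v, w} L) =>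
      generated E B c π S :=
  fun _ _ hST => sInf_le ⟨generated_identity E B c π _, fun _ _ h => generated_base E B c π _ h,
    fun _ hb => generated_witness E B c π (hST hb)⟩

/-- Each generating condition involves at most one witnessed pair, so it already holds for some
finite set. -/
theorem generated_univ :
    generated E B c π Set.univ = ⨆ S : Finset (WitnessTerm.{u, v, w} L ×
      WitnessTerm.{u, v, w} L), generated E B c π S := by
  classical
  apply le_antisymm
  · refine sInf_le ⟨fun e he a => ?_, fun a b hab => ?_, fun b _ => ?_⟩
    · exact le_iSup (fun S : Finset (WitnessTerm.{u, v, w} L ×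
        WitnessTerm.{u, v, w} L) => generated E B c π S) ∅ _ _
        (generated_identity E B c π _ e he a)
    · exact le_iSup (fun S : Finset (WitnessTerm.{u, v, w} L ×
        WitnessTerm.{u, v, w} L) => generated E B c π S) ∅ _ _
        (generated_base E B c π _ hab)
    · exact le_iSup (fun S : Finset (WitnessTerm.{u, v, w} L ×
        WitnessTerm.{u, v, w} L) => generated E B c π S) {b} _ _
        (generated_witness E B c π (by simp))
  · exact iSup_le fun S => sInf_le ⟨generated_identity E B c π _,
      fun _ _ h => generated_base E B c π _ h, fun _ _ => generated_witness E B c π trivial⟩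

variable {E B c π} in
theorem generated_le_comap_eval {A : Type*} [L.Structure A] (hA : Satisfies E A)
    {S : Set (WitnessTerm.{u, v, w} L × WitnessTerm.{u, v, w} L)} {a : Var n → A}
    {θ : Congruence L A} (hB : ∀ b d, B b d → θ.r (eval p a b) (eval p a d))
    (hS : ∀ b ∈ S, θ.r (eval p a (c b)) (eval p a (π b))) :
    generated E B c π S ≤ θ.comap (eval p a) (eval_funMap p a) := by
  refine sInf_le ⟨fun e he b => ?_, hB, hS⟩
  change θ.r (eval p a (e.1.realize b)) (eval p a (e.2.realize b))
  rw [realize_comp_of_map_funMap (eval p a) (eval_funMap p a),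
    realize_comp_of_map_funMap (eval p a) (eval_funMap p a), hA e he]

end Generated

/-! ### BFC in the generic algebra -/

section Generic

variable (E : Identities L) (S : Set (WitnessTerm.{u, v, w} L × WitnessTerm.{u, v, w} L))

/-- The generic congruence `θ`. -/
def thetaGen : Congruence L (WitnessTerm.{u, v, w} L) :=
  generated E (fun a b => a = z ∧ b = x ∨ a = w ∧ b = y) (fun b => X b.1 b.2) Prod.fst S

/-- The generic congruence `θ*`. -/
def thetaStarGen : Congruence L (WitnessTerm.{u, v, w} L) :=
  generated E (fun a b => a = y ∧ b = x) (fun b => X b.1 b.2) Prod.snd S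

/-- The generic congruence `φ`. -/
def phiGen : Congruence L (WitnessTerm.{u, v, w} L) :=
  generated E (fun a b => a = w ∧ b = z) (fun b => Y b.1 b.2) Prod.fst S

/-- The generic congruence `φ*`. -/
def phiStarGen : Congruence L (WitnessTerm.{u, v, w} L) :=
  generated E (fun _ _ => False) (fun b => Y b.1 b.2) Prod.snd S

/-- Boolean factor congruences, applied to a generic algebra with two decompositions. -/
theorem exists_generic_of_hasBFC (hE : HasBFC.{u, v, w} E) :
    ∃ N, (phiGen.{u, v, w} E Set.univ ⊔ Congruence.delta (thetaGen E Set.univ)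
      (thetaStarGen E Set.univ) (phiGen E Set.univ) (phiStarGen E Set.univ) N).r x y := by
  set θ := thetaGen.{u, v, w} E Set.univ
  set θs := thetaStarGen.{u, v, w} E Set.univ
  set φ := phiGen.{u, v, w} E Set.univ
  set φs := phiStarGen.{u, v, w} E Set.univ
  apply Congruence.exists_sup_delta_of_sup_deltaLimit
  set Ω := Congruence.deltaLimit θ θs φ φs
  -- The identities lie in both `θ` and `θs`, hence in `Ω`, so the quotient belongs to the variety.
  have hsat : Satisfies E (Congruence.Quo Ω) := Congruence.satisfies_quo fun e he a =>
    Congruence.inf_le_deltaLimit θ θs φ φs _ _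
      ⟨generated_identity E _ _ _ _ e he a, generated_identity E _ _ _ _ e he a⟩
  have hcθ := Congruence.complementary_mapQuo (θ := Ω) (φ := θ ⊔ Ω) (φs := θs ⊔ Ω)
    le_sup_right le_sup_right (Congruence.sup_deltaLimit_inf_sup_deltaLimit θ θs φ φs)
    fun a b => ⟨X a b,
      (le_sup_left : θ ≤ θ ⊔ Ω) _ _ (θ.symm (generated_witness E _ _ _ (b := (a, b)) trivial)),
      (le_sup_left : θs ≤ θs ⊔ Ω) _ _ (generated_witness E _ _ _ (b := (a, b)) trivial)⟩
  have hcφ := Congruence.complementary_mapQuo (θ := Ω) (φ := φ ⊔ Ω) (φs := φs ⊔ Ω)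
    le_sup_right le_sup_right (Congruence.sup_deltaLimit_inf_sup_deltaLimit' θ θs φ φs)
    fun a b => ⟨Y a b,
      (le_sup_left : φ ≤ φ ⊔ Ω) _ _ (φ.symm (generated_witness E _ _ _ (b := (a, b)) trivial)),
      (le_sup_left : φs ≤ φs ⊔ Ω) _ _ (generated_witness E _ _ _ (b := (a, b)) trivial)⟩
  set Θ := Congruence.mapQuo (θ := Ω) (φ := θ ⊔ Ω) le_sup_right
  set Θs := Congruence.mapQuo (θ := Ω) (φ := θs ⊔ Ω) le_sup_right
  set Φ := Congruence.mapQuo (θ := Ω) (φ := φ ⊔ Ω) le_sup_right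
  let mk : WitnessTerm.{u, v, w} L → Congruence.Quo Ω := Quotient.mk Ω.toSetoid
  have hΘ : ∀ {a b}, θ.r a b → Θ.r (mk a) (mk b) := fun h =>
    (Congruence.mapQuo_r _).2 ((le_sup_left : θ ≤ θ ⊔ Ω) _ _ h)
  have hΘs : ∀ {a b}, θs.r a b → Θs.r (mk a) (mk b) := fun h =>
    (Congruence.mapQuo_r _).2 ((le_sup_left : θs ≤ θs ⊔ Ω) _ _ h)
  have hΦ : ∀ {a b}, φ.r a b → Φ.r (mk a) (mk b) := fun h =>
    (Congruence.mapQuo_r _).2 ((le_sup_left : φ ≤ φ ⊔ Ω) _ _ h)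
  have hzx : Θ.r (mk z) (mk x) := hΘ (generated_base E _ _ _ _ (by simp))
  have hwy : Θ.r (mk w) (mk y) := hΘ (generated_base E _ _ _ _ (by simp))
  have hyx : Θs.r (mk y) (mk x) := hΘs (generated_base E _ _ _ _ (by simp))
  have hwz : Φ.r (mk w) (mk z) := hΦ (generated_base E _ _ _ _ (by simp))
  have : Nonempty (Congruence.Quo Ω) := ⟨mk x⟩
  -- As `Θs ⊓ Θ = ⊥`, distributivity reduces `Θs ⊓ (Θ ⊔ Φ)` to `Θs ⊓ Φ`; the path `x Θ z Φ w Θ y`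
  -- puts `(x, y)` in the former.
  have hdist := (hE (Congruence.Quo Ω) hsat).2 Θs ⟨Θ, hcθ.symm⟩ Θ ⟨Θs, hcθ⟩ Φ ⟨_, hcφ⟩
  have hl : Θ ≤ Θ ⊔ Φ := le_sup_left
  have hr : Φ ≤ Θ ⊔ Φ := le_sup_right
  have hxy : (Θs ⊓ (Θ ⊔ Φ)).r (mk x) (mk y) :=
    ⟨Θs.symm hyx, (Θ ⊔ Φ).trans (hl _ _ (Θ.symm hzx))
      ((Θ ⊔ Φ).trans (hr _ _ (Φ.symm hwz)) (hl _ _ hwy))⟩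
  rw [hdist, hcθ.symm.1, bot_sup_eq] at hxy
  exact (Congruence.mapQuo_r _).1 hxy.2

/-- For fixed `N`, `φ ∨ δ_N` is the directed union of its versions with finitely many witness
conditions. -/
theorem exists_finite_generic_of_hasBFC (hE : HasBFC.{u, v, w} E) :
    ∃ (N : ℕ) (S : Finset (WitnessTerm.{u, v, w} L × WitnessTerm.{u, v, w} L)),
      (phiGen E S ⊔ Congruence.delta (thetaGen E S) (thetaStarGen E S) (phiGen E S)
        (phiStarGen E S) N).r x y := by
  classical
  obtain ⟨N, h⟩ := exists_generic_of_hasBFC E hE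
  refine ⟨N, ?_⟩
  have hθ := generated_monotone.{u, v, w} E (fun a b => a = z ∧ b = x ∨ a = w ∧ b = y)
    (fun b => X b.1 b.2) Prod.fst
  have hθs := generated_monotone.{u, v, w} E (fun a b => a = y ∧ b = x)
    (fun b => X b.1 b.2) Prod.snd
  have hφ := generated_monotone.{u, v, w} E (fun a b => a = w ∧ b = z)
    (fun b => Y b.1 b.2) Prod.fst
  have hφs := generated_monotone.{u, v, w} E (fun _ _ => False) (fun b => Y b.1 b.2) Prod.snd
  have hmono := (Congruence.deltaEps_monotone hθ hθs hφ hφs N).1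
  rw [Congruence.delta, thetaGen, thetaStarGen, phiGen, phiStarGen, generated_univ, generated_univ,
    generated_univ, generated_univ] at h
  rw [(Congruence.deltaEps_iSup hθ hθs hφ hφs N).1, ← iSup_sup_eq] at h
  exact (Congruence.iSup_r_of_monotone (hφ.sup hmono)).1 h

end Generic

end WitnessTerm

/-! ### The two implications -/

theorem factorsDecompose_of_terms {L : FirstOrder.Language.{u, v}} {A : Type*} [L.Structure A]
    {N n : ℕ} {s t : (j : Fin n) → L.Term (Var j)}
    (h : ∀ (θ θs φ φs : Congruence L A) (X : Var n → A),
      Congruence.Cg L X (sigma s X) ≤ θ → Congruence.Cg L X (sigmaStar t X) ≤ θs →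
      Congruence.Cg L X (rho s X) ≤ φ → Congruence.Cg L X (rhoStar t X) ≤ φs →
      (φ ⊔ Congruence.delta θ θs φ φs N).r (X Var.x) (X Var.y)) :
    Congruence.FactorsDecompose L A := by
  rintro θ θs φ hθ ⟨φs, hφ⟩ x y z w hxy hxz hyw hzw
  obtain ⟨X, hX, rfl, rfl⟩ := exists_isSolution s t hθ hφ (θ.symm hxz) (θ.symm hyw)
    (θs.symm hxy) (φ.symm hzw)
  have := h θ θs φ φs X hX.Cg_sigma_le hX.Cg_sigmaStar_le hX.Cg_rho_le hX.Cg_rhoStar_le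
  rwa [Congruence.delta_eq_bot hθ.1 hφ.1, sup_bot_eq] at this

/-- The terms express each listed pair in the preceding generators. A solution `X` makes evaluation
at `X` send the four generic congruences into the given ones. -/
theorem exists_terms_of_hasBFC {L : FirstOrder.Language.{u, v}} {E : Identities L}
    (hE : HasBFC.{u, v, w} E) :
    ∃ (N n : ℕ) (s t : (j : Fin n) → L.Term (Var j)),
      ∀ (A : Type (max u w)) [L.Structure A], Satisfies E A →
        ∀ (θ θs φ φs : Congruence L A) (X : Var n → A), IsSolution s t θ θs φ φs X →
          (φ ⊔ Congruence.delta θ θs φ φs N).r (X Var.x) (X Var.y) := by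
  obtain ⟨N, S, h⟩ := WitnessTerm.exists_finite_generic_of_hasBFC E hE
  obtain ⟨p, n, hp, hS⟩ := WitnessTerm.exists_good S
  choose s hs using fun j : Fin n => (hp.2 j j.isLt).1
  choose t ht using fun j : Fin n => (hp.2 j j.isLt).2
  refine ⟨N, n, s, t, fun A _ hA θ θs φ φs X hX => ?_⟩
  have hgX : ∀ i : Fin n,
      WitnessTerm.eval p X (.X (p i).1 (p i).2) = X (.xs i) :=
    fun i => WitnessTerm.eval_gens hp X (.xs i)
  have hgY : ∀ i : Fin n,
      WitnessTerm.eval p X (.Y (p i).1 (p i).2) = X (.ys i) :=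
    fun i => WitnessTerm.eval_gens hp X (.ys i)
  have hes : ∀ i : Fin n, WitnessTerm.eval p X (p i).1 =
      (s i).realize fun v : Var (i : ℕ) => X (v.lift i.isLt.le) := fun i => by
    rw [← WitnessTerm.eval_realize hp X i.isLt.le, hs]
  have het : ∀ i : Fin n, WitnessTerm.eval p X (p i).2 =
      (t i).realize fun v : Var (i : ℕ) => X (v.lift i.isLt.le) := fun i => by
    rw [← WitnessTerm.eval_realize hp X i.isLt.le, ht]
  have hS' : ∀ b ∈ S, ∃ i : Fin n, p i = b := fun b hb =>
    let ⟨i, hi, h⟩ := hS b hb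
    ⟨⟨i, hi⟩, h⟩
  have h₁ : WitnessTerm.thetaGen E S ≤ θ.comap _ (WitnessTerm.eval_funMap p X) := by
    refine WitnessTerm.generated_le_comap_eval hA ?_ fun b hb => ?_
    · rintro _ _ (⟨rfl, rfl⟩ | ⟨rfl, rfl⟩)
      exacts [hX.z_x, hX.w_y]
    · obtain ⟨i, rfl⟩ := hS' b hb
      rw [hgX, hes]
      exact hX.xs_s i
  have h₂ : WitnessTerm.thetaStarGen E S ≤ θs.comap _ (WitnessTerm.eval_funMap p X) := by
    refine WitnessTerm.generated_le_comap_eval hA ?_ fun b hb => ?_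
    · rintro _ _ ⟨rfl, rfl⟩
      exact hX.y_x
    · obtain ⟨i, rfl⟩ := hS' b hb
      rw [hgX, het]
      exact hX.xs_t i
  have h₃ : WitnessTerm.phiGen E S ≤ φ.comap _ (WitnessTerm.eval_funMap p X) := by
    refine WitnessTerm.generated_le_comap_eval hA ?_ fun b hb => ?_
    · rintro _ _ ⟨rfl, rfl⟩
      exact hX.w_z
    · obtain ⟨i, rfl⟩ := hS' b hb
      rw [hgY, hes]
      exact hX.ys_s i
  have h₄ : WitnessTerm.phiStarGen E S ≤ φs.comap _ (WitnessTerm.eval_funMap p X) := by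
    refine WitnessTerm.generated_le_comap_eval hA (fun _ _ h => h.elim) fun b hb => ?_
    obtain ⟨i, rfl⟩ := hS' b hb
    rw [hgY, het]
    exact hX.ys_t i
  exact Congruence.sup_le_comap _ (WitnessTerm.eval_funMap p X) h₃
    (Congruence.deltaEps_le_comap _ (WitnessTerm.eval_funMap p X) h₁ h₂ h₃ h₄ N).1 _ _ h

end UA

theorem mainTheorem3 (L : FirstOrder.Language.{u, v}) [L.IsAlgebraic] (E : UA.Identities L) :
    UA.HasBFC.{u, v, w} E ↔
      ∃ (N n : ℕ) (s t : (j : Fin n) → L.Term (UA.Var j)),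
        ∀ (A : Type (max u w)) [L.Structure A] [Nonempty A], UA.Satisfies E A →
          ∀ (θ θs φ φs : UA.Congruence L A) (X : UA.Var n → A),
            UA.Congruence.Cg L X (UA.sigma s X) ≤ θ →
            UA.Congruence.Cg L X (UA.sigmaStar t X) ≤ θs →
            UA.Congruence.Cg L X (UA.rho s X) ≤ φ →
            UA.Congruence.Cg L X (UA.rhoStar t X) ≤ φs →
              (φ ⊔ UA.Congruence.delta θ θs φ φs N).r (X UA.Var.x) (X UA.Var.y) := by
  constructor
  · intro hE
    obtain ⟨N, n, s, t, h⟩ := UA.exists_terms_of_hasBFC hE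
    exact ⟨N, n, s, t, fun A _ _ hA θ θs φ φs X h₁ h₂ h₃ h₄ =>
      h A hA θ θs φ φs X (UA.isSolution_of_Cg_le h₁ h₂ h₃ h₄)⟩
  · rintro ⟨N, n, s, t, h⟩ A _ _ hA
    have H := UA.factorsDecompose_of_terms (h A hA)
    exact ⟨H.isSublattice, fun θ hθ φ hφ ψ hψ => H.inf_sup_left hθ hφ hψ⟩
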